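/- Let $p$ be a prime number and let $R$ be a reduced Noetherian commutative ring of characteristic $p$ which is $F$-finite, i.e. $R$ is a finite module over itself via the Frobenius $F\colon x\mapsto x^p$. Write ${}^1R$ for $R$ regarded as an $R$-module via Frobenius. Assume that $R$ is $F$-injective: for every prime ideal $P$ of $R$, with $\mathfrak m=PR_P$, and every $i\ge 0$, the map $H^i_{\mathfrak m}(R_P)\to H^i_{\mathfrak m}({}^1(R_P))$ on local cohomology induced by Frobenius is injective. Then $R$ is weakly normal, and in particular seminormal. (This applies in particular when $R$ has a dualizing complex; no such assumption is needed.) Here a finite extension $A\subseteq B$ of reduced rings is called subintegral (respectively weakly subintegral) if it induces a bijection $\operatorname{Spec}B\to\operatorname{Spec}A$ and, for every prime $P$ of $B$, the extension of residue fields $\kappa(P\cap A)\to\kappa(P)$ is an isomorphism (respectively purely inseparable). The seminormalization (respectively weak normalization) of $A$ in $B$ is the largest subring $A\subseteq C\subseteq B$ that is subintegral (respectively weakly subintegral) over $A$. A reduced ring $A$ is seminormal (respectively weakly normal) if it equals its seminormalization (respectively weak normalization) in the integral closure of $A$ in its total ring of fractions. -/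

import Mathlib

/-! ### Subintegral extensions, seminormality, weak normality -/

section Normality

universe u v

variable (A : Type u) (B : Type v) [CommRing A] [CommRing B] [Algebra A B]

/-- The homomorphism of residue fields `κ(P ∩ A) → κ(P)` attached to a prime `P` of `B`. -/
noncomputable def residueFieldMap (P : Ideal B) [P.IsPrime] :
    (P.comap (algebraMap A B)).ResidueField →+* P.ResidueField :=
  Ideal.ResidueField.map (P.comap (algebraMap A B)) P (algebraMap A B) rfl

/-- A finite extension `A ⊆ B` is subintegral if it induces a bijection on prime spectra and
isomorphisms on all residue fields. -/
structure IsSubintegralExtension : Prop where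
  injective : Function.Injective (algebraMap A B)
  finite : Module.Finite A B
  bijective_spec : Function.Bijective (PrimeSpectrum.comap (algebraMap A B))
  residueField : ∀ (P : Ideal B) [P.IsPrime], Function.Bijective (residueFieldMap A B P)

/-- A finite extension `A ⊆ B` is weakly subintegral if it induces a bijection on prime spectra
and purely inseparable extensions of all residue fields. -/
structure IsWeaklySubintegralExtension : Prop where
  injective : Function.Injective (algebraMap A B)
  finite : Module.Finite A B
  bijective_spec : Function.Bijective (PrimeSpectrum.comap (algebraMap A B))
  residueField : ∀ (P : Ideal B) [P.IsPrime],
    @IsPurelyInseparable (P.comap (algebraMap A B)).ResidueField P.ResidueField _ _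
      (residueFieldMap A B P).toAlgebra

/-- The seminormalization of `A` inside `B`: the largest subextension of `B` which is subintegral
over `A`, formed as the supremum of all of them. -/
noncomputable def seminormalizationIn : Subalgebra A B :=
  sSup {C : Subalgebra A B | IsSubintegralExtension A C}

/-- The weak normalization of `A` inside `B`: the largest subextension of `B` which is weakly
subintegral over `A`, formed as the supremum of all of them. -/
noncomputable def weakNormalizationIn : Subalgebra A B :=
  sSup {C : Subalgebra A B | IsWeaklySubintegralExtension A C}

/-- `A` is seminormal in `B` if it equals its seminormalization inside `B`;
`⊥` is the image of `A` in `B`. -/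
def IsSeminormalIn : Prop := seminormalizationIn A B = ⊥

/-- `A` is weakly normal in `B` if it equals its weak normalization inside `B`. -/
def IsWeaklyNormalIn : Prop := weakNormalizationIn A B = ⊥

/-- A reduced ring is seminormal if it is seminormal in its integral closure in its total ring of
fractions (`FractionRing A` is the localization of `A` at its non-zero-divisors). -/
def IsSeminormalRing : Prop :=
  IsReduced A ∧ IsSeminormalIn A (integralClosure A (FractionRing A))

/-- A reduced ring is weakly normal if it is weakly normal in its integral closure in its total
ring of fractions. -/
def IsWeaklyNormalRing : Prop :=
  IsReduced A ∧ IsWeaklyNormalIn A (integralClosure A (FractionRing A))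

end Normality

/-! ### Frobenius, `F`-finite and `F`-injective rings -/

section Frobenius

universe u

open CategoryTheory

variable (R : Type u) [CommRing R] (p : ℕ) [Fact p.Prime] [CharP R p]

/-- `R` is `F`-finite if the Frobenius `x ↦ x ^ p` makes `R` a finite module over itself. -/
def IsFFinite : Prop := (frobenius R p).Finite

/-- The `R`-module `R` with scalar multiplication twisted by Frobenius: `r • x = r ^ p * x`. -/
noncomputable def frobeniusModule : ModuleCat.{u} R :=
  (ModuleCat.restrictScalars (frobenius R p)).obj (ModuleCat.of R R)

/-- Frobenius `x ↦ x ^ p` as an `R`-linear map from `R` to its Frobenius twist. -/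
noncomputable def frobeniusLinear : ModuleCat.of R R ⟶ frobeniusModule R p :=
  ModuleCat.ofHom (Y := frobeniusModule R p)
    { toFun := fun x => (frobenius R p x : R)
      map_add' := fun x y => (frobenius R p).map_add x y
      map_smul' := fun r x => (frobenius R p).map_mul r x }

/-- A local ring `(R, m)` of characteristic `p` is `F`-injective if Frobenius induces injective
maps on all local cohomology modules `H^i_m`. -/
def IsFInjectiveLocal [IsLocalRing R] : Prop :=
  ∀ i : ℕ, Function.Injective
    ((localCohomology (IsLocalRing.maximalIdeal R) i).map (frobeniusLinear R p)).hom

instance charP_localization_atPrime (P : Ideal R) [P.IsPrime] :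
    CharP (Localization.AtPrime P) p := by
  let _ : Algebra (ZMod p) R := ZMod.algebra R p
  let _ : Algebra (ZMod p) (Localization.AtPrime P) :=
    ((algebraMap R (Localization.AtPrime P)).comp (algebraMap (ZMod p) R)).toAlgebra
  exact charP_of_injective_algebraMap (algebraMap (ZMod p) (Localization.AtPrime P)).injective p

/-- A ring of characteristic `p` is `F`-injective if all its localizations at primes are. -/
def IsFInjective : Prop :=
  ∀ (P : Ideal R) [P.IsPrime], IsFInjectiveLocal (Localization.AtPrime P) p

end Frobenius

/-! F-injectivity forces R to contain every y in its total ring of fractions with y^p in R, and only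
H^1 is needed for this. Write y = a/b and suppose I = (b : a) is proper. At a minimal prime P of I
some power m^n of the maximal ideal lies in I R_P, so x ↦ xy maps m^n into R_P and defines a class
in H^1_m(R_P). Frobenius sends it to the class of x ↦ x^p y^p, which is scalar multiplication on the
ring element y^p of the twisted module, hence zero. By injectivity x ↦ xy agrees on some m^k with
multiplication by a ring element, so y lies in R_P, a contradiction
(`IsFInjective.dvd_of_pow_dvd_pow`).

Now let A ⊆ B be weakly subintegral with A closed under p-th roots in B. At a minimal prime P of the
conductor, elements of the unique prime of B over P are nilpotent modulo the conductor localized at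
P. Pure inseparability then puts a p-power of each s in B into A, up to a factor outside P, and root
closure brings s itself down. As B is finite, one factor outside P works for all of B and lies in
the conductor: a contradiction unless A = B
(`IsWeaklySubintegralExtension.surjective_of_root_closed`). -/

/-! ### Explicit cocycles for Ext¹. -/

section ExtOne

open CategoryTheory Limits Opposite

namespace ProjectiveResolution

variable {C D : Type*} [Category* C] [Category* D] [Abelian C] [HasProjectiveResolutions C]
  [Abelian D]

/-- The map from a left derived functor to the opcycles of the complex computing it. -/
noncomputable def leftDerivedToOpcycles {X : C} (P : ProjectiveResolution X) (F : C ⥤ D)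
    [F.Additive] (n : ℕ) : (F.leftDerived n).obj X ⟶
      ((F.mapHomologicalComplex _).obj P.complex).opcycles n :=
  CategoryStruct.comp
    (Y := HomologicalComplex.homology ((F.mapHomologicalComplex _).obj P.complex) n)
    (P.isoLeftDerivedObj F n).hom
    (HomologicalComplex.homologyι ((F.mapHomologicalComplex _).obj P.complex) n)

theorem leftDerived_app_comp_toOpcycles {X : C} (P : ProjectiveResolution X) {F G : C ⥤ D}
    [F.Additive] [G.Additive] (α : F ⟶ G) (n : ℕ) :
    (NatTrans.leftDerived α n).app X ≫ leftDerivedToOpcycles P G n =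
      leftDerivedToOpcycles P F n ≫
        HomologicalComplex.opcyclesMap ((NatTrans.mapHomologicalComplex α _).app P.complex) n := by
  have h := HomologicalComplex.homologyι_naturality
    ((NatTrans.mapHomologicalComplex α _).app P.complex) n
  have h' : (NatTrans.leftDerived α n).app X ≫ (P.isoLeftDerivedObj G n).hom =
      (P.isoLeftDerivedObj F n).hom ≫ (HomologicalComplex.homologyFunctor D _ n).map
        ((NatTrans.mapHomologicalComplex α _).app P.complex) := by
    rw [ProjectiveResolution.leftDerived_app_eq α P n, Category.assoc, Category.assoc,
      Iso.inv_hom_id, Category.comp_id]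
  refine (Category.assoc _ _ _).symm.trans ?_
  refine (congrArg (fun t => CategoryStruct.comp t (HomologicalComplex.homologyι
    ((G.mapHomologicalComplex _).obj P.complex) n)) h').trans ?_
  refine (Category.assoc _ _ _).trans ?_
  refine Eq.trans ?_ (Category.assoc _ _ _).symm
  exact congrArg (fun t => CategoryStruct.comp (P.isoLeftDerivedObj F n).hom t) h

theorem leftDerived_map_comp_toOpcycles {X X' : C} (P : ProjectiveResolution X)
    (P' : ProjectiveResolution X') (f : X' ⟶ X) (g : P'.complex ⟶ P.complex)
    (hg : g.f 0 ≫ P.π.f 0 = P'.π.f 0 ≫ f) (F : C ⥤ D) [F.Additive] (n : ℕ) :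
    (F.leftDerived n).map f ≫ leftDerivedToOpcycles P F n =
      leftDerivedToOpcycles P' F n ≫
        HomologicalComplex.opcyclesMap ((F.mapHomologicalComplex _).map g) n := by
  have h := HomologicalComplex.homologyι_naturality ((F.mapHomologicalComplex _).map g) n
  have h' := ProjectiveResolution.isoLeftDerivedObj_hom_naturality f P' P g hg F n
  refine (Category.assoc _ _ _).symm.trans ?_
  refine (congrArg (fun t => CategoryStruct.comp t (HomologicalComplex.homologyι
    ((F.mapHomologicalComplex _).obj P.complex) n)) h').trans ?_
  refine (Category.assoc _ _ _).trans ?_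
  refine Eq.trans ?_ (Category.assoc _ _ _).symm
  exact congrArg (fun t => CategoryStruct.comp (P'.isoLeftDerivedObj F n).hom t) h

end ProjectiveResolution

universe v w u

variable {R : Type w} [Ring R] {C : Type u} [Category.{v} C] [Abelian C] [Linear R C]
  [EnoughProjectives C]

/-- The complex `Hom(P, Y)` attached to a resolution `P`, with values in the opposite category. -/
noncomputable abbrev ProjectiveResolution.homOp (R : Type w) [Ring R] [Linear R C] {X : C}
    (P : ProjectiveResolution X) (Y : C) : ChainComplex (ModuleCat.{v} R)ᵒᵖ ℕ :=
  (((linearYoneda R C).obj Y).rightOp.mapHomologicalComplex _).obj P.complex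

/-- The map from `1`-cocycles of `Hom(P, Y)` to `Ext¹(X, Y)`. -/
noncomputable def extOneOfCocycle {X : C} (P : ProjectiveResolution X) (Y : C) :
    ((ProjectiveResolution.homOp R P Y).opcycles 1).unop ⟶
      ((Ext R C 1).obj (op X)).obj Y :=
  (ProjectiveResolution.leftDerivedToOpcycles P ((linearYoneda R C).obj Y).rightOp 1).unop

/-- `x : Ext¹(X, Y)` is the class of the cocycle `z : P₁ ⟶ Y`. -/
def RepresentsExtOne {X : C} (P : ProjectiveResolution X) {Y : C}
    (x : ((Ext R C 1).obj (op X)).obj Y) (z : P.complex.X 1 ⟶ Y) : Prop :=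
  ∃ w : ((ProjectiveResolution.homOp R P Y).opcycles 1).unop,
    extOneOfCocycle P Y w = x ∧
      ((ProjectiveResolution.homOp R P Y).pOpcycles 1).unop w = z

namespace RepresentsExtOne

theorem exists_of_cocycle {X : C} (P : ProjectiveResolution X) {Y : C}
    (z : P.complex.X 1 ⟶ Y) (hz : P.complex.d 2 1 ≫ z = 0) :
    ∃ x : ((Ext R C 1).obj (op X)).obj Y, RepresentsExtOne P x z := by
  have hex := (ShortComplex.exact_of_g_is_cokernel
    (ShortComplex.mk ((ProjectiveResolution.homOp R P Y).d 2 1)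
      ((ProjectiveResolution.homOp R P Y).pOpcycles 1)
        (HomologicalComplex.d_pOpcycles _ 2 1))
    ((ProjectiveResolution.homOp R P Y).opcyclesIsCokernel 2 1 (by simp))).unop
  rw [ShortComplex.moduleCat_exact_iff] at hex
  obtain ⟨w, hw⟩ := hex z hz
  exact ⟨_, w, rfl, hw⟩

/-- Dualizing the kernel sequence of homology inside opcycles shows that the kernel from cocycles to
Ext¹ is exactly the coboundaries. -/
theorem eq_zero_iff {X : C} {P : ProjectiveResolution X} {Y : C}
    {x : ((Ext R C 1).obj (op X)).obj Y} {z : P.complex.X 1 ⟶ Y} (h : RepresentsExtOne P x z) :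
    x = 0 ↔ ∃ y : P.complex.X 0 ⟶ Y, P.complex.d 1 0 ≫ y = z := by
  let K := ProjectiveResolution.homOp R P Y
  obtain ⟨w, rfl, rfl⟩ := h
  have hex := (ShortComplex.exact_of_f_is_kernel
    (ShortComplex.mk (K.homologyι 1) (K.fromOpcycles 1 0) (by simp))
    (K.homologyIsKernel 1 0 (by simp))).unop
  rw [ShortComplex.moduleCat_exact_iff] at hex
  have hd : (K.fromOpcycles 1 0).unop ≫ (K.pOpcycles 1).unop = (K.d 1 0).unop := by
    rw [← unop_comp, HomologicalComplex.p_fromOpcycles]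
  have hι : extOneOfCocycle P Y w = 0 ↔ (K.homologyι 1).unop w = 0 := by
    have : IsIso (P.isoLeftDerivedObj ((linearYoneda R C).obj Y).rightOp 1).hom.unop :=
      inferInstance
    have hi := (ModuleCat.mono_iff_injective
      (P.isoLeftDerivedObj ((linearYoneda R C).obj Y).rightOp 1).hom.unop).1 inferInstance
    exact map_eq_zero_iff _ hi
  rw [hι]
  constructor
  · intro h0
    obtain ⟨y, hy⟩ := hex w h0
    refine ⟨y, ?_⟩
    rw [← hy]
    exact (ConcreteCategory.congr_hom hd y).symm
  · rintro ⟨y, hy⟩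
    have hp : Mono (K.pOpcycles 1).unop := inferInstance
    have : (K.fromOpcycles 1 0).unop y = w := by
      apply (ModuleCat.mono_iff_injective _).1 hp
      exact (ConcreteCategory.congr_hom hd y).trans hy
    rw [← this]
    exact (ShortComplex.mk (K.homologyι 1) (K.fromOpcycles 1 0) (by simp)).unop.moduleCat_zero_apply y

theorem map {X : C} {P : ProjectiveResolution X} {Y Y' : C} (f : Y ⟶ Y')
    {x : ((Ext R C 1).obj (op X)).obj Y} {z : P.complex.X 1 ⟶ Y} (h : RepresentsExtOne P x z) :
    RepresentsExtOne P (((Ext R C 1).obj (op X)).map f x) (z ≫ f) := by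
  obtain ⟨w, rfl, rfl⟩ := h
  let φ : ProjectiveResolution.homOp R P Y' ⟶ ProjectiveResolution.homOp R P Y :=
    (NatTrans.mapHomologicalComplex (NatTrans.rightOp ((linearYoneda R C).map f)) _).app P.complex
  refine ⟨(HomologicalComplex.opcyclesMap φ 1).unop w, ?_, ?_⟩
  · have h1 : (NatTrans.leftDerived (NatTrans.rightOp ((linearYoneda R C).map f)) 1).app X ≫
        (extOneOfCocycle (R := R) P Y).op = (extOneOfCocycle (R := R) P Y').op ≫
          HomologicalComplex.opcyclesMap φ 1 := 
      ProjectiveResolution.leftDerived_app_comp_toOpcycles P _ 1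
    exact (ConcreteCategory.congr_hom (congrArg Quiver.Hom.unop h1) w).symm
  · exact ConcreteCategory.congr_hom
      (congrArg Quiver.Hom.unop (HomologicalComplex.p_opcyclesMap φ 1)) w

theorem precomp {X X' : C} {P : ProjectiveResolution X} {P' : ProjectiveResolution X'} {Y : C}
    (f : X' ⟶ X) (g : P'.complex ⟶ P.complex) (hg : g.f 0 ≫ P.π.f 0 = P'.π.f 0 ≫ f)
    {x : ((Ext R C 1).obj (op X)).obj Y} {z : P.complex.X 1 ⟶ Y} (h : RepresentsExtOne P x z) :
    RepresentsExtOne P' (((Ext R C 1).map f.op).app Y x) (g.f 1 ≫ z) := by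
  obtain ⟨w, rfl, rfl⟩ := h
  let φ : ProjectiveResolution.homOp R P' Y ⟶ ProjectiveResolution.homOp R P Y :=
    (((linearYoneda R C).obj Y).rightOp.mapHomologicalComplex _).map g
  refine ⟨(HomologicalComplex.opcyclesMap φ 1).unop w, ?_, ?_⟩
  · have h1 : (((linearYoneda R C).obj Y).rightOp.leftDerived 1).map f ≫
        (extOneOfCocycle (R := R) P Y).op = (extOneOfCocycle (R := R) P' Y).op ≫
          HomologicalComplex.opcyclesMap φ 1 := 
      ProjectiveResolution.leftDerived_map_comp_toOpcycles P P' f g hg _ 1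
    exact (ConcreteCategory.congr_hom (congrArg Quiver.Hom.unop h1) w).symm
  · exact ConcreteCategory.congr_hom
      (congrArg Quiver.Hom.unop (HomologicalComplex.p_opcyclesMap φ 1)) w

end RepresentsExtOne

end ExtOne

/-! ### Classes in H¹_J coming from homomorphisms J^n → N. -/

section LocalCohomologyOne

open CategoryTheory Limits Opposite

universe u

variable {S : Type u} [CommRing S]

/-- The image in `H¹_J(N)` of an element of `Ext¹(S/Jⁿ, N)`. -/
noncomputable def localCohomologyι (J : Ideal S) (i n : ℕ) (N : ModuleCat.{u} S) :
    ((Ext S (ModuleCat.{u} S) i).obj (op (ModuleCat.of S (S ⧸ J ^ n)))).obj N ⟶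
      (localCohomology J i).obj N :=
  (colimit.ι (localCohomology.diagram (localCohomology.idealPowersDiagram J) i)
    (op (op n))).app N

theorem localCohomologyι_naturality (J : Ideal S) (i n : ℕ) {N M : ModuleCat.{u} S} (f : N ⟶ M) :
    localCohomologyι J i n N ≫ (localCohomology J i).map f =
      ((Ext S (ModuleCat.{u} S) i).obj (op (ModuleCat.of S (S ⧸ J ^ n)))).map f ≫
        localCohomologyι J i n M :=
  ((colimit.ι (localCohomology.diagram (localCohomology.idealPowersDiagram J) i)
    (op (op n))).naturality f).symm

theorem exists_map_app_eq_zero_of_colimit_ι_app_eq_zero {K : Type} [SmallCategory K]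
    [IsFiltered K] {E : Type*} [Category* E] (D : K ⥤ E ⥤ ModuleCat.{u} S) (j : K) (N : E)
    (x : (D.obj j).obj N) (hx : (colimit.ι D j).app N x = 0) :
    ∃ (k : K) (f : j ⟶ k), (D.map f).app N x = 0 := by
  have : PreservesFilteredColimitsOfSize.{0, 0} (forget (ModuleCat.{u} S)) :=
    preservesFilteredColimitsOfSize_shrink.{0, u, 0, u} _
  have hc := isColimitOfPreserves ((evaluation _ _).obj N) (colimit.isColimit D)
  obtain ⟨k, f, g, h⟩ := Concrete.isColimit_exists_of_rep_eq (D ⋙ (evaluation _ _).obj N) hc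
    (i := j) (j := j) x 0 (hx.trans (map_zero ((colimit.ι D j).app N).hom).symm)
  exact ⟨k, f, h.trans (map_zero ((D.map g).app N).hom)⟩

theorem exists_ext_map_eq_zero_of_localCohomologyι_eq_zero (J : Ideal S) (i n : ℕ)
    (N : ModuleCat.{u} S)
    (x : ((Ext S (ModuleCat.{u} S) i).obj (op (ModuleCat.of S (S ⧸ J ^ n)))).obj N)
    (hx : localCohomologyι J i n N x = 0) :
    ∃ (m : ℕ) (h : J ^ m ≤ J ^ n), ((Ext S (ModuleCat.{u} S) i).map
      (ModuleCat.ofHom (Submodule.mapQ (J ^ m) (J ^ n) LinearMap.id h)).op).app N x = 0 := by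
  obtain ⟨k, f, h⟩ := exists_map_app_eq_zero_of_colimit_ι_app_eq_zero
    (localCohomology.diagram (localCohomology.idealPowersDiagram J) i) (op (op n)) N x hx
  exact ⟨k.unop.unop, ((localCohomology.idealPowersDiagram J).map f.unop).down.down, h⟩

/-- The connecting map Hom(J^n, N) → Ext¹(S/J^n, N) sends φ to a class that dies in H¹_J(M), since f
∘ φ extends to S by 1 ↦ m. Hence it dies in H¹_J(N), so already at a finite stage k, which says that
φ restricted to J^k extends to S. -/
theorem exists_mul_eq_of_localCohomology_injective (J : Ideal S) {N M : ModuleCat.{u} S}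
    (f : N ⟶ M) (hf : Function.Injective ((localCohomology J 1).map f).hom) (n : ℕ)
    (φ : ↥(J ^ n) →ₗ[S] N) (m : M) (hφ : ∀ x : ↥(J ^ n), f (φ x) = (x : S) • m) :
    ∃ (k : ℕ) (h : J ^ k ≤ J ^ n) (r : N),
      ∀ (x : S) (hx : x ∈ J ^ k), φ ⟨x, h hx⟩ = x • r := by
  let X := ModuleCat.of S (S ⧸ J ^ n)
  let P : ProjectiveResolution X := projectiveResolution X
  let q : ModuleCat.of S S ⟶ X := ModuleCat.ofHom (Submodule.mkQ (J ^ n))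
  have hq : Epi q := (ModuleCat.epi_iff_surjective q).2 (Submodule.mkQ_surjective _)
  let π : P.complex.X 0 ⟶ X := P.π.f 0
  let g : P.complex.X 0 ⟶ ModuleCat.of S S := Projective.factorThru π q
  have hg : g ≫ q = P.π.f 0 := Projective.factorThru_comp π q
  have hgd (y : P.complex.X 1) : g (P.complex.d 1 0 y) ∈ J ^ n := by
    have h0 : P.complex.d 1 0 ≫ g ≫ q = 0 := by
      rw [hg]
      exact P.complex_d_comp_π_f_zero
    exact (Submodule.Quotient.mk_eq_zero _).1 (ConcreteCategory.congr_hom h0 y)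
  -- The connecting map on cocycles: lift P₀ → S/J^n to g with values in S; then g ∘ d lands in J^n,
  -- where φ applies.
  let z : P.complex.X 1 ⟶ N := ModuleCat.ofHom
    (φ ∘ₗ LinearMap.codRestrict (J ^ n) (P.complex.d 1 0 ≫ g).hom hgd)
  have hz : P.complex.d 2 1 ≫ z = 0 := by
    ext y
    have h0 : (P.complex.d 2 1 ≫ P.complex.d 1 0) ≫ g = 0 := by
      rw [P.complex.d_comp_d, zero_comp]
    have h1 : (⟨g (P.complex.d 1 0 (P.complex.d 2 1 y)), hgd _⟩ : ↥(J ^ n)) = 0 :=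
      Subtype.ext (ConcreteCategory.congr_hom h0 y)
    exact (congrArg φ h1).trans (map_zero φ)
  obtain ⟨x, hx⟩ := RepresentsExtOne.exists_of_cocycle (R := S) P z hz
  have hfx := (hx.map f).eq_zero_iff.2 ⟨g ≫ ModuleCat.ofHom (LinearMap.toSpanSingleton S M m), by
    ext y
    exact (hφ ⟨_, hgd y⟩).symm⟩
  have hιx : localCohomologyι J 1 n N x = 0 := by
    apply hf
    rw [map_zero]
    refine (ConcreteCategory.congr_hom (localCohomologyι_naturality J 1 n f) x).trans ?_
    exact (congrArg (localCohomologyι J 1 n M) hfx).trans (map_zero (localCohomologyι J 1 n M).hom)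
  obtain ⟨k, hk, hxk⟩ := exists_ext_map_eq_zero_of_localCohomologyι_eq_zero J 1 n N x hιx
  let X' := ModuleCat.of S (S ⧸ J ^ k)
  let P' : ProjectiveResolution X' := projectiveResolution X'
  let t : X' ⟶ X := ModuleCat.ofHom (Submodule.mapQ (J ^ k) (J ^ n) LinearMap.id hk)
  let G := ProjectiveResolution.lift t P' P
  have hG : G.f 0 ≫ P.π.f 0 = P'.π.f 0 ≫ t := ProjectiveResolution.lift_commutes_zero t P' P
  obtain ⟨h, hh⟩ := (hx.precomp t G hG).eq_zero_iff.1 hxk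
  obtain ⟨e, he⟩ := (ModuleCat.epi_iff_surjective (P'.π.f 0)).1 inferInstance
    (Submodule.mkQ (J ^ k) 1)
  have hi : g (G.f 0 e) - 1 ∈ J ^ n := by
    rw [← Submodule.Quotient.mk_eq_zero, Submodule.Quotient.mk_sub, sub_eq_zero]
    have h1 : q (g (G.f 0 e)) = t (P'.π.f 0 e) :=
      (ConcreteCategory.congr_hom hg (G.f 0 e)).trans (ConcreteCategory.congr_hom hG e)
    rw [he] at h1
    exact h1
  -- Here e lifts 1 and h bounds the restricted cocycle, so h(xe) = φ(x g(Ge)) for x in J^k. The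
  -- term φ(g(Ge) - 1) corrects for g(Ge) being 1 only modulo J^n.
  refine ⟨k, hk, h e - φ ⟨_, hi⟩, fun x hx => ?_⟩
  have hxe : P'.π.f 0 (x • e) = 0 := by
    have h1 : x • Submodule.mkQ (J ^ k) 1 = 0 := by
      rw [← map_smul]
      exact (Submodule.Quotient.mk_eq_zero _).2 (by simpa using hx)
    exact (map_smul (P'.π.f 0).hom x e).trans ((congrArg (x • ·) he).trans h1)
  obtain ⟨y, hy⟩ := (ShortComplex.moduleCat_exact_iff _).1 P'.exact₀ (x • e) hxe
  have h1 : h (x • e) = z (G.f 1 y) := by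
    rw [← hy]
    exact ConcreteCategory.congr_hom hh y
  have h2 : P.complex.d 1 0 (G.f 1 y) = x • G.f 0 e := by
    have := ConcreteCategory.congr_hom (G.comm 1 0) y
    refine this.trans ?_
    rw [← map_smul]
    exact congrArg (G.f 0) hy
  have h3 : z (G.f 1 y) = φ (⟨x, hk hx⟩ + x • ⟨_, hi⟩) := by
    refine congrArg φ (Subtype.ext ?_)
    change g (P.complex.d 1 0 (G.f 1 y)) = x + x * (g (G.f 0 e) - 1)
    rw [h2, map_smul, smul_eq_mul]
    ring
  rw [h3, map_smul, map_add, map_smul] at h1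
  rw [smul_sub, h1, add_sub_cancel_right]

end LocalCohomologyOne

/-! ### F-injective rings are closed under p-th roots. -/

section RootClosed

universe u v

open nonZeroDivisors

theorem dvd_of_pow_dvd_pow_of_frobenius_injective {S : Type u} [CommRing S] (p : ℕ)
    [Fact p.Prime] [CharP S p] (J : Ideal S)
    (hJ : Function.Injective ((localCohomology J 1).map (frobeniusLinear S p)).hom)
    {a b : S} (hb : b ∈ S⁰) (hbJ : b ∈ J) (n : ℕ) (hn : ∀ x ∈ J ^ n, b ∣ x * a)
    (h : b ^ p ∣ a ^ p) : b ∣ a := by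
  have hreg : ∀ x y : S, b * x = b * y → x = y := fun x y hxy =>
    (mul_cancel_left_mem_nonZeroDivisors hb).1 hxy
  choose q hq using hn
  obtain ⟨c, hc⟩ := h
  -- Multiplication by a/b; linearity is checked after multiplying by the regular element b.
  let φ : ↥(J ^ n) →ₗ[S] ModuleCat.of S S :=
    { toFun := fun x => q x x.2
      map_add' := fun x y => hreg _ _ <| by
        change b * q _ _ = b * (q _ _ + q _ _)
        rw [mul_add, ← hq, ← hq, ← hq, Submodule.coe_add, add_mul]
      map_smul' := fun r x => hreg _ _ <| by
        change b * q _ _ = b * (r * q _ _)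
        rw [mul_left_comm, ← hq, ← hq, Submodule.coe_smul, smul_eq_mul, mul_assoc] }
  obtain ⟨k, hk, r, hr⟩ := exists_mul_eq_of_localCohomology_injective J (frobeniusLinear S p) hJ n
    φ (show S from c) (fun x => by
      change (q x x.2) ^ p = (x : S) ^ p * c
      refine (mul_cancel_left_mem_nonZeroDivisors (pow_mem hb p)).1 ?_
      rw [← mul_pow, ← hq, mul_pow, hc]
      ring)
  -- Evaluating at b^k, a regular element of J^k, identifies a/b with r.
  have hbk := Ideal.pow_mem_pow hbJ k
  have h1 : q (b ^ k) (hk hbk) = b ^ k * r := hr (b ^ k) hbk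
  refine ⟨r, (mul_cancel_left_mem_nonZeroDivisors (pow_mem hb k)).1 ?_⟩
  rw [hq (b ^ k) (hk hbk), h1, mul_left_comm]

theorem IsFInjective.dvd_of_pow_dvd_pow {R : Type u} [CommRing R] [IsNoetherianRing R] (p : ℕ)
    [Fact p.Prime] [CharP R p] (hR : IsFInjective R p) {a b : R} (hb : b ∈ R⁰)
    (h : b ^ p ∣ a ^ p) : b ∣ a := by
  let I : Ideal R := Submodule.comap (LinearMap.mulRight R a) (Ideal.span {b})
  have hI (x : R) : x ∈ I ↔ b ∣ x * a := Ideal.mem_span_singleton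
  by_contra hba
  have hI1 : I ≠ ⊤ := fun h1 => hba <| by
    simpa using (hI 1).1 (h1 ▸ Submodule.mem_top)
  obtain ⟨P, hP⟩ := Ideal.nonempty_minimalPrimes hI1
  have hPp : P.IsPrime := hP.1.1
  let S := Localization.AtPrime P
  let f := algebraMap R S
  have hrad := IsLocalization.AtPrime.radical_map_of_mem_minimalPrimes S P I hP
  rw [Localization.AtPrime.map_eq_maximalIdeal] at hrad
  obtain ⟨n, hn⟩ := Ideal.exists_pow_le_of_le_radical_of_fg hrad.ge (IsNoetherian.noetherian _)
  have hbP : b ∈ P := hP.1.2 ((hI b).2 (dvd_mul_right b a))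
  have hbS : f b ∈ S⁰ := IsLocalization.map_nonZeroDivisors_le P.primeCompl S ⟨b, hb, rfl⟩
  have hle : I.map f ≤ Submodule.comap (LinearMap.mulRight S (f a)) (Ideal.span {f b}) := by
    rw [Ideal.map_le_iff_le_comap]
    intro x hx
    refine Ideal.mem_span_singleton.2 ?_
    change f b ∣ f x * f a
    rw [← map_mul]
    exact map_dvd f ((hI x).1 hx)
  have hdvd : f b ∣ f a := by
    refine dvd_of_pow_dvd_pow_of_frobenius_injective p (IsLocalRing.maximalIdeal S) (hR P 1) hbS
      ((IsLocalization.AtPrime.to_map_mem_maximal_iff S P b).2 hbP) n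
      (fun x hx => Ideal.mem_span_singleton.1 (hle (hn hx))) ?_
    rw [← map_pow, ← map_pow]
    exact map_dvd f h
  obtain ⟨s, hs⟩ := hdvd
  obtain ⟨⟨d, t⟩, hd⟩ := IsLocalization.surj P.primeCompl s
  have h1 : f (t * a) = f (b * d) := by
    rw [map_mul, map_mul, hs, ← hd]
    ring
  obtain ⟨w, hw⟩ := (IsLocalization.eq_iff_exists P.primeCompl S).1 h1
  have hmem : (w * t : R) ∈ I := (hI _).2 ⟨w * d, by
    rw [mul_assoc, hw]
    ring⟩
  exact (w * t).2 (hP.1.2 hmem)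

theorem IsFInjective.mem_range_of_pow_mem_range {R : Type u} [CommRing R] [IsNoetherianRing R]
    (p : ℕ) [Fact p.Prime] [CharP R p] (hR : IsFInjective R p) {y : FractionRing R}
    (hy : y ^ p ∈ (algebraMap R (FractionRing R)).range) :
    y ∈ (algebraMap R (FractionRing R)).range := by
  obtain ⟨r, hr⟩ := hy
  obtain ⟨⟨a, b⟩, hab⟩ := IsLocalization.surj R⁰ y
  have hinj := IsFractionRing.injective R (FractionRing R)
  have h1 : a ^ p = b ^ p * r := hinj <| by
    rw [map_mul, map_pow, map_pow, hr, ← hab, mul_pow, mul_comm]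
  obtain ⟨d, hd⟩ := hR.dvd_of_pow_dvd_pow p b.2 ⟨r, h1⟩
  refine ⟨d, ?_⟩
  apply (IsLocalization.map_units (FractionRing R) b).mul_right_cancel
  rw [hab, ← map_mul, mul_comm]
  exact congrArg _ hd.symm

end RootClosed

/-! ### Weakly subintegral extensions of root-closed rings are trivial. -/

section WeaklySubintegral

universe u v

variable {A : Type u} {B : Type v} [CommRing A] [CommRing B] [Algebra A B]

/-- The elements of `B` which multiply `B` into the image of `A`, after localizing at `P`. -/
def localConductor (B : Type v) [CommRing B] [Algebra A B] (P : Ideal A) [P.IsPrime] :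
    Ideal B where
  carrier := {z | ∃ t ∉ P, ∀ c : B, algebraMap A B t * z * c ∈ (algebraMap A B).range}
  zero_mem' := ⟨1, P.one_notMem, fun c => ⟨0, by simp⟩⟩
  add_mem' := by
    rintro x y ⟨s, hs, hx⟩ ⟨t, ht, hy⟩
    refine ⟨s * t, P.primeCompl.mul_mem hs ht, fun c => ?_⟩
    rw [show algebraMap A B (s * t) * (x + y) * c = algebraMap A B s * x * (algebraMap A B t * c) +
      algebraMap A B t * y * (algebraMap A B s * c) by rw [map_mul]; ring]
    exact add_mem (hx _) (hy _)
  smul_mem' := by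
    rintro r x ⟨s, hs, hx⟩
    refine ⟨s, hs, fun c => ?_⟩
    rw [show algebraMap A B s * (r • x) * c = algebraMap A B s * x * (r * c) by
      rw [smul_eq_mul]; ring]
    exact hx _

variable (A B) in
/-- The conductor of `A` in `B`. -/
def conductorIdeal : Ideal A where
  carrier := {r | ∀ c : B, algebraMap A B r * c ∈ (algebraMap A B).range}
  zero_mem' := fun c => ⟨0, by simp⟩
  add_mem' := fun hx hy c => by
    rw [map_add, add_mul]
    exact add_mem (hx c) (hy c)
  smul_mem' := fun r x hx c => by
    rw [smul_eq_mul, map_mul, mul_assoc]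
    exact mul_mem ⟨r, rfl⟩ (hx c)

/-- Otherwise some prime Q' contains the local conductor and avoids both A \ P and the powers of y.
Its contraction lies between the conductor and P, so equals P by minimality; injectivity on spectra
gives Q' = Q, which contains y. -/
theorem exists_pow_mem_localConductor
    (hB : Function.Injective (PrimeSpectrum.comap (algebraMap A B))) (Q : Ideal B) [Q.IsPrime]
    (hQ : Q.comap (algebraMap A B) ∈ (conductorIdeal A B).minimalPrimes) {y : B} (hy : y ∈ Q) :
    ∃ n : ℕ, y ^ n ∈ localConductor B (Q.comap (algebraMap A B)) := by
  set P := Q.comap (algebraMap A B) with hP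
  by_contra! hn
  let M : Submonoid B := P.primeCompl.map (algebraMap A B) ⊔ Submonoid.powers y
  have hdisj : Disjoint (localConductor B P : Set B) M := by
    rw [Set.disjoint_left]
    rintro z ⟨s, hs, hz⟩ hzM
    obtain ⟨_, ⟨t, ht, rfl⟩, _, ⟨n, rfl⟩, rfl⟩ := Submonoid.mem_sup.1 hzM
    refine hn n ⟨s * t, P.primeCompl.mul_mem hs ht, fun c => ?_⟩
    have := hz c
    rwa [← mul_assoc, ← map_mul] at this
  obtain ⟨Q', hQ', hle, hd⟩ := Ideal.exists_le_prime_disjoint _ M hdisj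
  have hle' : Q'.comap (algebraMap A B) ≤ P := fun r hr => by
    by_contra hrP
    exact Set.disjoint_left.1 hd hr
      (Submonoid.mem_sup_left (Submonoid.mem_map_of_mem _ (show r ∈ P.primeCompl from hrP)))
  have hJ : conductorIdeal A B ≤ Q'.comap (algebraMap A B) := fun r hr =>
    hle ⟨1, P.one_notMem, fun c => by
      rw [map_one, one_mul]
      exact hr c⟩
  have heq : Q'.comap (algebraMap A B) = P :=
    le_antisymm hle' (hQ.2 ⟨inferInstance, hJ⟩ hle')
  have hQQ : (⟨Q', hQ'⟩ : PrimeSpectrum B) = ⟨Q, inferInstance⟩ :=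
    hB (PrimeSpectrum.ext heq)
  have hQQ' : Q' = Q := congrArg PrimeSpectrum.asIdeal hQQ
  exact Set.disjoint_left.1 hd (hQQ'.symm ▸ hy)
    (Submonoid.mem_sup_right (Submonoid.mem_powers y))

theorem charP_residueField (p : ℕ) [Fact p.Prime] [CharP A p] (P : Ideal A) [P.IsPrime] :
    CharP P.ResidueField p := by
  refine (CharP.charP_iff_prime_eq_zero Fact.out).2 ?_
  rw [← map_natCast (algebraMap A P.ResidueField), CharP.cast_eq_zero, map_zero]

theorem IsWeaklySubintegralExtension.exists_mul_pow_sub_mem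
    (h : IsWeaklySubintegralExtension A B) (p : ℕ) [Fact p.Prime] [CharP A p] (Q : Ideal B)
    [Q.IsPrime] (s : B) :
    ∃ (e : ℕ) (r u : A), u ∉ Q.comap (algebraMap A B) ∧
      algebraMap A B u * s ^ p ^ e - algebraMap A B r ∈ Q := by
  let P := Q.comap (algebraMap A B)
  let κ : P.ResidueField →+* Q.ResidueField := residueFieldMap A B Q
  have hκ (x : A) : κ (algebraMap A P.ResidueField x) =
      algebraMap B Q.ResidueField (algebraMap A B x) := Ideal.ResidueField.map_algebraMap _ _ _ _ _
  have := charP_residueField p P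
  have hp : p.Prime := Fact.out
  have : ExpChar P.ResidueField p := ExpChar.prime hp
  let _ := κ.toAlgebra
  have hpi : IsPurelyInseparable P.ResidueField Q.ResidueField := h.residueField Q
  obtain ⟨e, x, hx⟩ := IsPurelyInseparable.pow_mem P.ResidueField p (algebraMap B Q.ResidueField s)
  obtain ⟨r, u, hu, hru⟩ := IsFractionRing.div_surjective (A := A ⧸ P) x
  obtain ⟨r, rfl⟩ := Ideal.Quotient.mk_surjective r
  obtain ⟨u, rfl⟩ := Ideal.Quotient.mk_surjective u
  have huP : u ∉ P := fun h0 => nonZeroDivisors.ne_zero hu (Ideal.Quotient.eq_zero_iff_mem.2 h0)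
  rw [Ideal.algebraMap_quotient_residueField_mk, Ideal.algebraMap_quotient_residueField_mk] at hru
  refine ⟨e, r, u, huP, ?_⟩
  rw [← Ideal.algebraMap_residueField_eq_zero, map_sub, map_mul, map_pow, ← hx, ← hκ, ← hκ, ← hru]
  change κ _ * κ _ - κ _ = 0
  rw [← map_mul, mul_div_cancel₀ _ (fun h0 => huP (Ideal.algebraMap_residueField_eq_zero.1 h0)),
    sub_self]

theorem mem_range_of_pow_pow_mem_range (p : ℕ)
    (hroot : ∀ c : B, c ^ p ∈ (algebraMap A B).range → c ∈ (algebraMap A B).range) (e : ℕ) (c : B)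
    (hc : c ^ p ^ e ∈ (algebraMap A B).range) : c ∈ (algebraMap A B).range := by
  induction e generalizing c with
  | zero => simpa using hc
  | succ e ih => exact hroot c (ih _ (by rwa [← pow_mul, ← pow_succ']))

theorem IsWeaklySubintegralExtension.exists_mul_mem_range
    (h : IsWeaklySubintegralExtension A B) (p : ℕ) [Fact p.Prime] [CharP A p]
    (hroot : ∀ c : B, c ^ p ∈ (algebraMap A B).range → c ∈ (algebraMap A B).range)
    (Q : Ideal B) [Q.IsPrime]
    (hQ : Q.comap (algebraMap A B) ∈ (conductorIdeal A B).minimalPrimes) (s : B) :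
    ∃ t ∉ Q.comap (algebraMap A B), algebraMap A B t * s ∈ (algebraMap A B).range := by
  have hp : p.Prime := Fact.out
  have : CharP B p := by
    refine ⟨fun x => ?_⟩
    rw [← CharP.cast_eq_zero_iff A p, ← map_natCast (algebraMap A B),
      map_eq_zero_iff _ h.injective]
  obtain ⟨e, r, u, hu, hy⟩ := h.exists_mul_pow_sub_mem p Q s
  obtain ⟨n, hn⟩ := exists_pow_mem_localConductor h.bijective_spec.1 Q hQ hy
  -- The exponent is raised from n to p^n so that the power of u s^(p^e) - r expands additively.
  obtain ⟨t, ht, htn⟩ := Ideal.pow_mem_of_pow_mem (n := p ^ n) _ hn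
    (Nat.lt_pow_self hp.one_lt).le
  have hprime : (Q.comap (algebraMap A B)).IsPrime := inferInstance
  refine ⟨t * u, hprime.mul_notMem ht hu, ?_⟩
  apply mem_range_of_pow_pow_mem_range p hroot (e + n)
  have h1 := htn 1
  rw [mul_one, sub_pow_char_pow, mul_pow, ← pow_mul, ← pow_add] at h1
  have h2 : algebraMap A B t * algebraMap A B u ^ p ^ n * s ^ p ^ (e + n) ∈
      (algebraMap A B).range := by
    have h3 := add_mem h1 (show algebraMap A B (t * r ^ p ^ n) ∈ (algebraMap A B).range from
      ⟨_, rfl⟩)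
    rw [map_mul, map_pow] at h3
    convert h3 using 1
    ring
  -- The factors t^w and u^v complete t · u^(p^n) · s^(p^(e+n)) to the full power (tus)^(p^(e+n)).
  obtain ⟨w, hw⟩ := Nat.exists_eq_add_of_le' (Nat.one_le_pow (e + n) p hp.pos)
  obtain ⟨v, hv⟩ := Nat.exists_eq_add_of_le'
    (Nat.pow_le_pow_right hp.pos (Nat.le_add_left n e))
  have h4 := mul_mem h2 (show algebraMap A B (t ^ w * u ^ v) ∈ (algebraMap A B).range from
    ⟨_, rfl⟩)
  convert h4 using 1
  rw [map_mul, mul_pow, mul_pow, map_mul, map_pow, map_pow]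
  nth_rw 1 [hw]
  nth_rw 1 [hv]
  ring

theorem IsWeaklySubintegralExtension.surjective_of_root_closed
    (h : IsWeaklySubintegralExtension A B) (p : ℕ) [Fact p.Prime] [CharP A p]
    (hroot : ∀ c : B, c ^ p ∈ (algebraMap A B).range → c ∈ (algebraMap A B).range) :
    Function.Surjective (algebraMap A B) := by
  by_contra hsurj
  have hJ : conductorIdeal A B ≠ ⊤ := fun htop => hsurj fun c => by
    have := (htop ▸ Submodule.mem_top : (1 : A) ∈ conductorIdeal A B) c
    rwa [map_one, one_mul] at this
  obtain ⟨P, hP⟩ := Ideal.nonempty_minimalPrimes hJ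
  obtain ⟨⟨Q, hQ⟩, hQP⟩ := h.bijective_spec.2 ⟨P, hP.1.1⟩
  have hQP' : Q.comap (algebraMap A B) = P := congrArg PrimeSpectrum.asIdeal hQP
  subst hQP'
  choose t ht hts using h.exists_mul_mem_range p hroot Q hP
  obtain ⟨G, hG⟩ := h.finite.fg_top
  have hprime : (Q.comap (algebraMap A B)).IsPrime := inferInstance
  have hnot : ∏ g ∈ G, t g ∉ Q.comap (algebraMap A B) :=
    prod_mem (S := (Q.comap (algebraMap A B)).primeCompl) fun g _ => ht g
  refine hnot (hP.1.2 fun c => ?_)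
  have hc : c ∈ Submodule.span A (G : Set B) := hG ▸ Submodule.mem_top
  induction hc using Submodule.span_induction with
  | mem g hg =>
    obtain ⟨d, hd⟩ := Finset.dvd_prod_of_mem t hg
    rw [hd, map_mul, mul_right_comm]
    exact mul_mem (hts g) ⟨d, rfl⟩
  | zero => exact ⟨0, by simp⟩
  | add x y _ _ hx hy =>
    rw [mul_add]
    exact add_mem hx hy
  | smul r x _ hx =>
    rw [Algebra.smul_def, mul_left_comm]
    exact mul_mem ⟨r, rfl⟩ hx

theorem IsSubintegralExtension.isWeaklySubintegralExtension (h : IsSubintegralExtension A B) :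
    IsWeaklySubintegralExtension A B where
  injective := h.injective
  finite := h.finite
  bijective_spec := h.bijective_spec
  residueField P _ := by
    let _ := (residueFieldMap A B P).toAlgebra
    refine isPurelyInseparable_iff.2 fun x => ?_
    obtain ⟨y, rfl⟩ := (h.residueField P).2 x
    exact ⟨isIntegral_algebraMap, fun _ => ⟨y, rfl⟩⟩

end WeaklySubintegral

theorem mainTheorem3 {R : Type*} [CommRing R] [IsNoetherianRing R] [IsReduced R]
    (p : ℕ) [Fact p.Prime] [CharP R p]
    (hfin : IsFFinite R p) (hinj : IsFInjective R p) :
    IsWeaklyNormalRing R ∧ IsSeminormalRing R := by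
  have hbot (C : Subalgebra R (integralClosure R (FractionRing R)))
      (hC : IsWeaklySubintegralExtension R C) : C ≤ ⊥ := by
    have hsurj := hC.surjective_of_root_closed p fun c hc => by
      obtain ⟨r, hr⟩ := hc
      have hr' : (algebraMap R (FractionRing R)) r = ((c : integralClosure R (FractionRing R)) :
          FractionRing R) ^ p :=
        congrArg (fun z : C => ((z : integralClosure R (FractionRing R)) : FractionRing R)) hr
      obtain ⟨d, hd⟩ := hinj.mem_range_of_pow_mem_range p ⟨r, hr'⟩
      exact ⟨d, Subtype.ext (Subtype.ext hd)⟩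
    intro x hx
    obtain ⟨r, hr⟩ := hsurj ⟨x, hx⟩
    exact Algebra.mem_bot.2 ⟨r, congrArg Subtype.val hr⟩
  refine ⟨⟨inferInstance, ?_⟩, ⟨inferInstance, ?_⟩⟩
  · exact le_bot_iff.1 (sSup_le fun C hC => hbot C hC)
  · exact le_bot_iff.1 (sSup_le fun C hC => hbot C hC.isWeaklySubintegralExtension)
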